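/- Let $X$ be a standard Borel space and let $G$ be a Borel graph on $X$, that is, a simple graph with vertex set $X$ whose edge relation is a Borel subset of $X\times X$. Suppose that the degrees of the vertices of $G$ are bounded by a natural number, that every connected component of $G$ is infinite, and that $G$ is hyperfinite, i.e. $G$ is the union of an increasing sequence of Borel graphs on $X$ all of whose connected components are finite. For a Borel graph $K$ on a standard Borel space, say that $K$ satisfies $(*)$ if there is an increasing sequence $K_1\subseteq K_2\subseteq\cdots\subseteq K$ of Borel graphs on the vertex set of $K$ such that $\bigcup_n K_n=K$ and, for every $n$, each connected component of $K_n$ is finite and has at least $n$ elements. Then: 1. For every Borel probability measure $\mu$ on $X$ there is a Borel set $A\subseteq X$ that is a union of connected components of $G$, with $\mu(X\setminus A)=0$, such that the induced graph $G\restriction A$ satisfies $(*)$. 2. For every Polish topology on $X$ whose Borel sets are the Borel sets of $X$ there is a Borel set $A\subseteq X$ that is a union of connected components of $G$, with $X\setminus A$ meager, such that $G\restriction A$ satisfies $(*)$. 3. If $G$ is generated by a single Borel function, i.e. there is a Borel function $f\colon X\to X$ such that distinct $x,y\in X$ are adjacent in $G$ if and only if $f(x)=y$ or $f(y)=x$,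 then $G$ itself satisfies $(*)$. -/

import Mathlib

/-- A simple graph on a measurable space is a Borel graph if its edge relation is a
measurable subset of the square of the vertex set. -/
def IsBorelGraph {X : Type*} [MeasurableSpace X] (G : SimpleGraph X) : Prop :=
  MeasurableSet {p : X × X | G.Adj p.1 p.2}

/-- All vertex degrees are bounded by one natural number. -/
def HasBoundedDegree {X : Type*} (G : SimpleGraph X) : Prop :=
  ∃ d : ℕ, ∀ x : X, (G.neighborSet x).encard ≤ d

/-- `H` witnesses that `G` is hyperfinite: an increasing sequence of Borel graphs with finite
connected components and with union `G` (in particular `H n ≤ G` for all `n`). -/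
structure IsHyperfiniteWitness {X : Type*} [MeasurableSpace X] (G : SimpleGraph X)
    (H : ℕ → SimpleGraph X) : Prop where
  borel : ∀ n, IsBorelGraph (H n)
  mono : Monotone H
  finite : ∀ n, ∀ c : (H n).ConnectedComponent, c.supp.Finite
  iSup_eq : ⨆ n, H n = G

/-- `G` is an increasing union of Borel graphs with finite connected components. -/
def IsHyperfinite {X : Type*} [MeasurableSpace X] (G : SimpleGraph X) : Prop :=
  ∃ H : ℕ → SimpleGraph X, IsHyperfiniteWitness G H

/-- `G` has a hyperfiniteness witness such that every connected component of its `n`-th graph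
has at least `n` elements. The graph with index `0` carries no size requirement, so that
indexing from `0` or from `1` makes no difference. -/
def HasLargeWitness {X : Type*} [MeasurableSpace X] (G : SimpleGraph X) : Prop :=
  ∃ H : ℕ → SimpleGraph X, IsHyperfiniteWitness G H ∧
    ∀ n : ℕ, ∀ c : (H n).ConnectedComponent, (n : ℕ∞) ≤ c.supp.encard

/-- `A` is a union of connected components of `G`. -/
def IsGraphInvariant {X : Type*} (G : SimpleGraph X) (A : Set X) : Prop :=
  ∀ x y : X, G.Adj x y → x ∈ A → y ∈ A

/-- The graph generated by a function `f`: distinct `x` and `y` are adjacent iff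
`f x = y` or `f y = x`. -/
def functionGraph {X : Type*} (f : X → X) : SimpleGraph X :=
  SimpleGraph.fromRel fun x y => f x = y

/-! All three parts hold with nothing discarded: `hasLargeWitness_of_isHyperfinite` shows that `G`
itself satisfies (*). Fix a hyperfiniteness witness `H` and call a Borel `K ≤ G` tame if every `K ⊔
H m` has finite components. It suffices to extend any tame graph to a tame graph with all components
strictly larger (`IsTame.exists_enlarge`): iterate from `⊥`, adding `H n` at stage `n` so that the
union is `G`.

To enlarge `K`, rank a component by the least `m` such that an edge of `H m` leaves it; such edges
of `H m` witness the rank. Merging along witnessing edges between equal ranks keeps tameness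
(`IsTame.exists_merge`). Afterwards the witnessing edges of an unchanged component lead to enlarged
components or to unchanged ones of strictly smaller rank. Attaching every unchanged component to
such a neighbour at once could build infinite trees. Instead, recursion on the rank yields a kernel
`T`: an unchanged component lies in `T` iff its witnessing edges all lead to unchanged components
outside `T`. Attach those outside `T` first, then the still unchanged ones in `T`. Each round
(`IsTame.exists_attach`) has depth one, so local finiteness preserves tameness.

All choices are Borel because bounded degree gives countably many Borel functions that cover each
component. -/

/-! ### Borel functions covering the components -/

/-- A Borel subset of a product whose vertical sections have at most `d` points has a Borel
projection and is covered by the graphs of countably many Borel functions. -/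
theorem exists_measurable_cover_of_section_encard_le.{u} {Y : Type u} [MeasurableSpace Y]
    [StandardBorelSpace Y] [Nonempty Y] (d : ℕ) :
    ∀ {Z : Type u} [MeasurableSpace Z] [StandardBorelSpace Z] (R : Set (Z × Y)),
      MeasurableSet R → (∀ z, {y | (z, y) ∈ R}.encard ≤ d) →
      MeasurableSet (Prod.fst '' R) ∧
        ∃ g : ℕ → Z → Y, (∀ i, Measurable (g i)) ∧ ∀ z y, (z, y) ∈ R → ∃ i, g i z = y := by
  classical
  induction d with
  | zero =>
    intro Z _ _ R _ hd
    have hR : R = ∅ := by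
      ext ⟨z, y⟩
      have := hd z
      simp only [Nat.cast_zero, nonpos_iff_eq_zero, Set.encard_eq_zero] at this
      simpa using Set.eq_empty_iff_forall_notMem.1 this y
    subst hR
    exact ⟨by simp, fun _ _ => Classical.arbitrary Y, fun _ => measurable_const, by simp⟩
  | succ d ih =>
    intro Z _ _ R hR hd
    let e : Y → ℝ := MeasureTheory.embeddingReal Y
    have he : MeasurableEmbedding e := MeasureTheory.measurableEmbedding_embeddingReal Y
    -- The projection `R'` of `Q` is `R` without the `e`-least point of each section. The sections
    -- of both `Q` and `R'` have at most `d` points, so the induction hypothesis applies twice, the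
    -- first time with `Z × Y` in place of `Z`.
    let Q : Set ((Z × Y) × Y) := {q | q.1 ∈ R ∧ (q.1.1, q.2) ∈ R ∧ e q.2 < e q.1.2}
    have hfst : Measurable fun q : (Z × Y) × Y => (q.1.1, q.2) := by fun_prop
    have hQ : MeasurableSet Q :=
      (measurable_fst hR).inter ((hfst hR).inter
        (measurableSet_lt (he.measurable.comp measurable_snd)
          (he.measurable.comp (measurable_snd.comp measurable_fst))))
    have remove : ∀ z y, (z, y) ∈ R → ({y' | (z, y') ∈ R} \ {y}).encard ≤ d := by
      intro z y hy
      have h := hd z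
      rw [← Set.encard_sdiff_singleton_add_one (show y ∈ {y' | (z, y') ∈ R} from hy)] at h
      push_cast at h
      exact (ENat.add_le_add_iff_right ENat.one_ne_top).1 h
    obtain ⟨hQp, -⟩ := ih Q hQ (by
      rintro ⟨z, y⟩
      by_cases hy : (z, y) ∈ R
      · refine (Set.encard_le_encard ?_).trans (remove z y hy)
        rintro y' ⟨-, h1, h2⟩
        exact ⟨h1, fun h => by subst h; exact lt_irrefl _ h2⟩
      · have : {y' | ((z, y), y') ∈ Q} = ∅ := by
          ext y'; simp [Q, hy]
        simp [this])
    set R' : Set (Z × Y) := Prod.fst '' Q with hR'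
    have hR'R : R' ⊆ R := by
      rintro _ ⟨q, hq, rfl⟩
      exact hq.1
    obtain ⟨hRp, g, hg, hgc⟩ := ih R' hQp (by
      intro z
      rcases Set.eq_empty_or_nonempty {y | (z, y) ∈ R} with h | h
      · have : {y | (z, y) ∈ R'} = ∅ :=
          Set.subset_eq_empty (fun y hy => hR'R hy) h
        simp [this]
      · have hfin : {y | (z, y) ∈ R}.Finite :=
          Set.finite_of_encard_le_coe (hd z)
        obtain ⟨y, hy, hmin⟩ := Set.exists_min_image _ e hfin h
        refine (Set.encard_le_encard ?_).trans (remove z y hy)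
        intro y' hy'
        refine ⟨hR'R hy', ?_⟩
        rintro rfl
        obtain ⟨⟨⟨z', y'⟩, y''⟩, ⟨-, h1, h2⟩, h3⟩ := hy'
        simp only [Prod.mk.injEq] at h3
        obtain ⟨rfl, rfl⟩ := h3
        exact absurd h2 (not_lt.2 (hmin y'' h1)))
    have hS : MeasurableSet (R \ R') := hR.diff hQp
    have hinj : Set.InjOn Prod.fst (R \ R') := by
      rintro ⟨z, y⟩ ⟨h1, h2⟩ ⟨z', y'⟩ ⟨h1', h2'⟩ (rfl : z = z')
      rcases lt_trichotomy (e y) (e y') with h | h | h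
      · exact absurd ⟨((z, y'), y), ⟨h1', h1, h⟩, rfl⟩ h2'
      · rw [he.injective h]
      · exact absurd ⟨((z, y), y'), ⟨h1, h1', h⟩, rfl⟩ h2
    -- Lusin–Souslin: the least points form a partial function, so the projection is injective on
    -- them.
    have hSp : ∀ T : Set (Z × Y), MeasurableSet T → T ⊆ R \ R' →
        MeasurableSet (Prod.fst '' T) := fun T hT hTS =>
      hT.image_of_measurable_injOn measurable_fst (hinj.mono hTS)
    refine ⟨?_, ?_⟩
    · have : Prod.fst '' R = Prod.fst '' R' ∪ Prod.fst '' (R \ R') := by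
        rw [← Set.image_union, Set.union_sdiff_cancel hR'R]
      rw [this]
      exact hRp.union (hSp _ hS subset_rfl)
    · let φ : Z → Y := fun z =>
        if h : ∃ y, (z, y) ∈ R \ R' then h.choose else Classical.arbitrary Y
      have hφ : ∀ z y, (z, y) ∈ R \ R' → φ z = y := by
        intro z y h
        have h' : ∃ y, (z, y) ∈ R \ R' := ⟨y, h⟩
        have := hinj h'.choose_spec h rfl
        simp only [φ, dif_pos h']
        exact (Prod.mk.inj this).2
      have hφm : Measurable φ := by
        intro B hB
        have : φ ⁻¹' B = Prod.fst '' ((R \ R') ∩ Prod.snd ⁻¹' B) ∪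
            ((Prod.fst '' (R \ R'))ᶜ ∩ {_z | Classical.arbitrary Y ∈ B}) := by
          ext z
          by_cases h : ∃ y, (z, y) ∈ R \ R'
          · obtain ⟨y, hy⟩ := h
            have hu : ∀ y', (z, y') ∈ R \ R' → y' = y := fun y' h' =>
              (hφ z y' h').symm.trans (hφ z y hy)
            constructor
            · intro hz
              exact Or.inl ⟨(z, y), ⟨hy, by simpa [hφ z y hy] using hz⟩, rfl⟩
            · rintro (⟨⟨z', y'⟩, ⟨h1, h2⟩, rfl⟩ | ⟨h1, -⟩)
              · simpa [hφ z' y' h1] using h2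
              · exact absurd ⟨(z, y), hy, rfl⟩ h1
          · have h1 : φ z = Classical.arbitrary Y := dif_neg h
            constructor
            · intro hz
              refine Or.inr ⟨?_, by simpa [h1] using hz⟩
              rintro ⟨⟨z', y'⟩, h', rfl⟩
              exact h ⟨y', h'⟩
            · rintro (⟨⟨z', y'⟩, ⟨h3, h2⟩, rfl⟩ | ⟨-, h2⟩)
              · exact absurd ⟨y', h3⟩ h
              · simpa [h1] using h2
        rw [this]
        exact (hSp _ (hS.inter (measurable_snd hB)) Set.inter_subset_left).union
          ((hSp _ hS subset_rfl).compl.inter (MeasurableSet.const _))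
      refine ⟨fun n => Nat.casesOn n φ g, fun n => ?_, fun z y h => ?_⟩
      · cases n with
        | zero => exact hφm
        | succ n => exact hg n
      · by_cases h' : (z, y) ∈ R'
        · obtain ⟨i, hi⟩ := hgc z y h'
          exact ⟨i + 1, hi⟩
        · exact ⟨0, hφ z y ⟨h, h'⟩⟩

/-- The components of a Borel graph of bounded degree are covered by countably many Borel
functions. -/
theorem exists_measurable_reachable_cover {X : Type*} [MeasurableSpace X] [StandardBorelSpace X]
    {G : SimpleGraph X} (hG : IsBorelGraph G) (hdeg : HasBoundedDegree G) :
    ∃ γ : ℕ → X → X, (∀ k, Measurable (γ k)) ∧ ∀ x y, G.Reachable x y → ∃ k, γ k x = y := by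
  rcases isEmpty_or_nonempty X with hX | hX
  · exact ⟨fun _ => id, fun _ => measurable_id, fun x => hX.elim x⟩
  obtain ⟨d, hd⟩ := hdeg
  obtain ⟨-, g, hg, hgc⟩ := exists_measurable_cover_of_section_encard_le d
    {p : X × X | G.Adj p.1 p.2} hG hd
  let δ : List ℕ → X → X := fun l => l.foldr (fun i f => f ∘ g i) id
  have hδ : ∀ l, Measurable (δ l) := by
    intro l
    induction l with
    | nil => exact measurable_id
    | cons i l ih => exact ih.comp (hg i)
  have hδc : ∀ x y, G.Reachable x y → ∃ l, δ l x = y := by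
    rintro x y ⟨p⟩
    induction p with
    | nil => exact ⟨[], rfl⟩
    | cons h _ ih =>
      obtain ⟨l, hl⟩ := ih
      obtain ⟨i, hi⟩ := hgc _ _ h
      exact ⟨i :: l, by simpa [δ, hi] using hl⟩
  obtain ⟨c, hc⟩ := exists_surjective_nat (List ℕ)
  refine ⟨fun k => δ (c k), fun k => hδ _, fun x y h => ?_⟩
  obtain ⟨l, hl⟩ := hδc x y h
  obtain ⟨k, rfl⟩ := hc l
  exact ⟨k, hl⟩

theorem IsBorelGraph.measurable_adj {X Z : Type*} [MeasurableSpace X] [MeasurableSpace Z]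
    {K : SimpleGraph X} (hK : IsBorelGraph K) {a b : Z → X} (ha : Measurable a)
    (hb : Measurable b) : Measurable fun z => K.Adj (a z) (b z) :=
  (measurableSet_setOfPred.1 hK).comp (ha.prodMk hb)

/-- A countable family of Borel functions covering the components of `G`. -/
structure IsReachableCover {X : Type*} [MeasurableSpace X] (G : SimpleGraph X)
    (γ : ℕ → X → X) : Prop where
  measurable : ∀ k, Measurable (γ k)
  cover : ∀ x y, G.Reachable x y → ∃ k, γ k x = y

/-- All connected components of `K` are finite. -/
def HasFiniteComponents {X : Type*} (K : SimpleGraph X) : Prop :=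
  ∀ x, {y | K.Reachable x y}.Finite

/-! ### Measurability of reachability and Borel transversals -/

section Reachable

variable {X Z : Type*} [MeasurableSpace X] [MeasurableSpace Z] {G K : SimpleGraph X}
  {γ : ℕ → X → X}

variable [StandardBorelSpace X]

/-- Recursion on path length. The last intermediate vertex ranges over the countably many `γ k x`,
which replaces a projection by a countable union. -/
theorem IsReachableCover.measurable_reachable (hγ : IsReachableCover G γ) (hK : IsBorelGraph K)
    (hle : K ≤ G) {a b : Z → X} (ha : Measurable a) (hb : Measurable b) :
    Measurable fun z => K.Reachable (a z) (b z) := by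
  let R : ℕ → X × X → Prop := fun n => Nat.rec (fun p => p.1 = p.2)
    (fun _ R p => ∃ k, R (p.1, γ k p.1) ∧ K.Adj (γ k p.1) p.2) n
  have hR : ∀ n, Measurable (R n) := by
    intro n
    induction n with
    | zero => exact measurableSet_setOfPred.1 (measurableSet_eq_fun measurable_fst measurable_snd)
    | succ n ih =>
      refine Measurable.exists fun k => ?_
      have h1 : Measurable fun p : X × X => γ k p.1 := (hγ.measurable k).comp measurable_fst
      exact (ih.comp (measurable_fst.prodMk h1)).and (hK.measurable_adj h1 measurable_snd)
  have hRiff : ∀ x y, K.Reachable x y ↔ ∃ n, R n (x, y) := by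
    intro x y
    constructor
    · intro h
      rw [SimpleGraph.reachable_iff_reflTransGen] at h
      induction h with
      | refl => exact ⟨0, rfl⟩
      | tail h1 h2 ih =>
        obtain ⟨n, hn⟩ := ih
        rw [← SimpleGraph.reachable_iff_reflTransGen] at h1
        obtain ⟨k, rfl⟩ := hγ.cover _ _ (h1.mono hle)
        exact ⟨n + 1, k, hn, h2⟩
    · rintro ⟨n, hn⟩
      induction n generalizing y with
      | zero =>
        have : x = y := hn
        rw [this]
      | succ n ih =>
        obtain ⟨k, h1, h2⟩ := hn
        exact (ih _ h1).trans h2.reachable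
  simp only [hRiff]
  exact Measurable.exists fun n => (hR n).comp (ha.prodMk hb)

/-- A Borel graph with finite components has a Borel transversal function. -/
theorem IsReachableCover.exists_measurable_selector (hγ : IsReachableCover G γ)
    (hK : IsBorelGraph K) (hle : K ≤ G) (hfin : HasFiniteComponents K) :
    ∃ t : X → X, Measurable t ∧ (∀ x, K.Reachable x (t x)) ∧
      ∀ x y, K.Reachable x y → t x = t y := by
  classical
  rcases isEmpty_or_nonempty X with hX | hX
  · exact ⟨id, measurable_id, fun x => hX.elim x, fun x => hX.elim x⟩
  let e : X → ℝ := MeasureTheory.embeddingReal X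
  have he : MeasurableEmbedding e := MeasureTheory.measurableEmbedding_embeddingReal X
  -- `γ k x` is the `e`-least point of the component of `x`. The index `k` depends on `x`, but the
  -- point depends only on the component.
  let p : ℕ → X → Prop := fun k x => K.Reachable x (γ k x) ∧
    ∀ j, K.Reachable x (γ j x) → e (γ k x) ≤ e (γ j x)
  have hex : ∀ x, ∃ k, p k x := by
    intro x
    obtain ⟨u, hu, hmin⟩ := Set.exists_min_image _ e (hfin x) ⟨x, SimpleGraph.Reachable.rfl⟩
    obtain ⟨k, rfl⟩ := hγ.cover x u (SimpleGraph.Reachable.mono hle hu)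
    exact ⟨k, hu, fun j hj => hmin _ hj⟩
  have hp : ∀ k, MeasurableSet {x | p k x} := by
    intro k
    refine measurableSet_setOfPred.2 ((hγ.measurable_reachable hK hle measurable_id
      (hγ.measurable k)).and (Measurable.forall fun j => Measurable.imp
        (hγ.measurable_reachable hK hle measurable_id (hγ.measurable j)) ?_))
    exact measurableSet_setOfPred.1 (measurableSet_le (he.measurable.comp (hγ.measurable k))
      (he.measurable.comp (hγ.measurable j)))
  have hle' : ∀ x y, K.Reachable x y →
      e (γ (Nat.find (hex x)) x) ≤ e (γ (Nat.find (hex y)) y) := by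
    intro x y h
    obtain ⟨hy, -⟩ := Nat.find_spec (hex y)
    obtain ⟨j, hj⟩ := hγ.cover x _ ((h.trans hy).mono hle)
    rw [← hj]
    exact (Nat.find_spec (hex x)).2 j (hj ▸ h.trans hy)
  refine ⟨fun x => γ (Nat.find (hex x)) x, Measurable.find hγ.measurable hp hex,
    fun x => (Nat.find_spec (hex x)).1, fun x y h => ?_⟩
  exact he.injective (le_antisymm (hle' x y h) (hle' y x h.symm))

end Reachable

/-! ### Preserving finite components -/

section FiniteComponents

variable {X : Type*} {K L G : SimpleGraph X}

theorem SimpleGraph.Reachable.apply_eq {α : Type*} {t : X → α}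
    (ht : ∀ a b, K.Adj a b → t a = t b) {x y : X} (h : K.Reachable x y) : t x = t y := by
  rw [SimpleGraph.reachable_iff_reflTransGen] at h
  induction h with
  | refl => rfl
  | tail _ h ih => exact ih.trans (ht _ _ h)

theorem HasFiniteComponents.of_fiber {α : Type*} {t : X → α}
    (ht : ∀ a b, K.Adj a b → t a = t b) (hfib : ∀ c, {x | t x = c}.Finite) :
    HasFiniteComponents K := fun x =>
  (hfib (t x)).subset fun _ hy => (SimpleGraph.Reachable.apply_eq ht hy).symm

theorem HasFiniteComponents.mono (h : HasFiniteComponents L) (hle : K ≤ L) :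
    HasFiniteComponents K := fun x => (h x).subset fun _ hy => SimpleGraph.Reachable.mono hle hy

/-- Attaching each component of `L` inside `B` to the component of a point `v x ∉ B` adjacent
to it preserves finiteness of the components. -/
theorem HasFiniteComponents.attach (hloc : ∀ x, (G.neighborSet x).Finite)
    (hL : HasFiniteComponents L) {B : Set X} {v : X → X}
    (hBL : ∀ a b, L.Adj a b → a ∈ B → b ∈ B ∧ v a = v b)
    (hv : ∀ x ∈ B, ∃ u, L.Reachable x u ∧ G.Adj u (v x))
    (hK : ∀ a b, K.Adj a b → L.Adj a b ∨ (a ∈ B ∧ b ∉ B ∧ b = v a) ∨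
      (b ∈ B ∧ a ∉ B ∧ a = v b)) :
    HasFiniteComponents K := by
  classical
  -- `t` is constant along edges of `K`. Its fibre over a component is covered by that component and
  -- the `L`-components of its finitely many `G`-neighbours.
  let t : X → L.ConnectedComponent := fun x =>
    if x ∈ B then L.connectedComponentMk (v x) else L.connectedComponentMk x
  refine HasFiniteComponents.of_fiber (t := t) ?_ ?_
  · have key : ∀ a b, a ∈ B ∧ b ∉ B ∧ b = v a → t a = t b := by
      rintro a b ⟨ha, hb, rfl⟩
      simp [t, ha, hb]
    intro a b hab
    rcases hK a b hab with h | h | h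
    · by_cases ha : a ∈ B
      · obtain ⟨hb, hvb⟩ := hBL a b h ha
        simp [t, ha, hb, hvb]
      · have hb : b ∉ B := fun hb => ha (hBL b a h.symm hb).1
        simpa [t, ha, hb] using h.reachable
    · exact key a b h
    · exact (key b a h).symm
  · intro c
    induction c using SimpleGraph.ConnectedComponent.ind with
    | h c =>
      have hfin : ((⋃ w ∈ {w | L.Reachable c w}, ⋃ u ∈ G.neighborSet w, {x | L.Reachable u x}) ∪
          {x | L.Reachable c x}).Finite :=
        ((hL c).biUnion fun w _ => (hloc w).biUnion fun u _ => hL u).union (hL c)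
      refine hfin.subset fun x hx => ?_
      by_cases hxB : x ∈ B
      · have hx' : L.Reachable (v x) c := by simpa [t, hxB] using hx
        obtain ⟨u, hu, huv⟩ := hv x hxB
        refine Or.inl (Set.mem_biUnion (x := v x) hx'.symm
          (Set.mem_biUnion (x := u) huv.symm hu.symm))
      · have hx' : L.Reachable x c := by simpa [t, hxB] using hx
        exact Or.inr hx'.symm

theorem SimpleGraph.Adj.sup_fromRel {R : X → X → Prop} {a b : X}
    (h : (K ⊔ SimpleGraph.fromRel R).Adj a b) : K.Adj a b ∨ R a b ∨ R b a := by
  rcases h with h | h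
  · exact Or.inl h
  · exact Or.inr ((SimpleGraph.fromRel_adj R a b).1 h).2

theorem SimpleGraph.adj_sup_fromRel {R : X → X → Prop} {a b : X} (hne : a ≠ b) (h : R a b) :
    (K ⊔ SimpleGraph.fromRel R).Adj a b :=
  Or.inr ((SimpleGraph.fromRel_adj R a b).2 ⟨hne, Or.inl h⟩)

theorem IsBorelGraph.sup [MeasurableSpace X] (hK : IsBorelGraph K) (hL : IsBorelGraph L) :
    IsBorelGraph (K ⊔ L) :=
  MeasurableSet.union hK hL

theorem isBorelGraph_fromRel [MeasurableSpace X] [StandardBorelSpace X] {R : X → X → Prop}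
    (hR : Measurable fun p : X × X => R p.1 p.2) : IsBorelGraph (SimpleGraph.fromRel R) := by
  have h1 : Measurable fun p : X × X => p.1 = p.2 :=
    measurableSet_setOfPred.1 (measurableSet_eq_fun measurable_fst measurable_snd)
  have h2 : Measurable fun p : X × X => R p.2 p.1 := hR.comp measurable_swap
  exact measurableSet_setOfPred.2 (h1.not.and (hR.or h2))

end FiniteComponents

/-! ### Ranks, tame graphs, merging and attaching -/

/-- Some edge of `L` leaves the component of `x` in `K`. -/
def Leaves {X : Type*} (K L : SimpleGraph X) (x : X) : Prop :=
  ∃ u, K.Reachable x u ∧ ∃ v, L.Adj u v ∧ ¬ K.Reachable x v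

/-- The least `m` such that an edge of `H m` leaves the component of `x` in `K`. -/
noncomputable def leaveRank {X : Type*} (H : ℕ → SimpleGraph X) (K : SimpleGraph X) (x : X) : ℕ :=
  sInf {m | Leaves K (H m) x}

/-- A Borel subgraph of `G` whose union with each `H m` has finite components. -/
structure IsTame {X : Type*} [MeasurableSpace X] (G : SimpleGraph X) (H : ℕ → SimpleGraph X)
    (K : SimpleGraph X) : Prop where
  borel : IsBorelGraph K
  le : K ≤ G
  finite : ∀ m, HasFiniteComponents (K ⊔ H m)

section Rank

variable {X : Type*} {G K K' : SimpleGraph X} {H : ℕ → SimpleGraph X}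

theorem leaves_congr {L : SimpleGraph X} {x y : X} (h : K.Reachable x y) :
    Leaves K L x ↔ Leaves K L y := by
  have h1 : ∀ z, K.Reachable x z ↔ K.Reachable y z := fun z =>
    ⟨fun h' => h.symm.trans h', fun h' => h.trans h'⟩
  simp only [Leaves, h1]

theorem leaveRank_congr {x y : X} (h : K.Reachable x y) : leaveRank H K x = leaveRank H K y := by
  simp only [leaveRank, leaves_congr h]

theorem leaveRank_eq_of_reachable_iff {x : X} (h : ∀ y, K.Reachable x y ↔ K'.Reachable x y) :
    leaveRank H K x = leaveRank H K' x := by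
  simp only [leaveRank, Leaves, h]

theorem leaveRank_le {m : ℕ} {a b : X} (h : (H m).Adj a b) (hn : ¬ K.Reachable a b) :
    leaveRank H K a ≤ m :=
  Nat.sInf_le ⟨a, .rfl, b, h, hn⟩

theorem reachable_of_lt_leaveRank {m : ℕ} {a b : X} (hm : m < leaveRank H K a)
    (h : (H m).Adj a b) : K.Reachable a b := by
  by_contra hn
  exact absurd (leaveRank_le h hn) (not_le.2 hm)

/-- Otherwise the finite `K`-component of `x` would be closed under the edges of `G` and so contain
the infinite `G`-component. This makes the infimum in `leaveRank` a genuine minimum. -/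
theorem exists_leaves (hsup : ⨆ n, H n = G) (hfin : HasFiniteComponents K)
    (hinf : ∀ x, {y | G.Reachable x y}.Infinite) (x : X) : ∃ m, Leaves K (H m) x := by
  by_contra hn
  refine hinf x ((hfin x).subset fun y hy => ?_)
  have hy' : G.Reachable x y := hy
  rw [SimpleGraph.reachable_iff_reflTransGen] at hy'
  show K.Reachable x y
  clear hy
  induction hy' with
  | refl => exact .rfl
  | @tail u v _ h ih =>
    by_contra hv
    rw [← hsup, SimpleGraph.iSup_adj] at h
    obtain ⟨m, hm⟩ := h
    exact hn ⟨m, _, ih, _, hm, hv⟩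

theorem leaves_leaveRank {x : X} (h : ∃ m, Leaves K (H m) x) :
    Leaves K (H (leaveRank H K x)) x :=
  Nat.sInf_mem h

variable [MeasurableSpace X] {γ : ℕ → X → X}

theorem IsTame.hasFiniteComponents (hK : IsTame G H K) : HasFiniteComponents K :=
  (hK.finite 0).mono le_sup_left

theorem measurable_rank_adj {Z : Type*} [MeasurableSpace Z] (hH : ∀ n, IsBorelGraph (H n))
    {r : Z → ℕ} (hr : Measurable r) {a b : Z → X} (ha : Measurable a) (hb : Measurable b) :
    Measurable fun z => (H (r z)).Adj (a z) (b z) := by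
  have h : ∀ z, (H (r z)).Adj (a z) (b z) ↔ ∃ n, r z = n ∧ (H n).Adj (a z) (b z) := by simp
  simp only [h]
  refine Measurable.exists fun n => Measurable.and ?_ ((hH n).measurable_adj ha hb)
  exact measurableSet_setOfPred.1 (hr (measurableSet_singleton n))

variable [StandardBorelSpace X]

theorem measurable_leaves (hγ : IsReachableCover G γ) {L : SimpleGraph X} (hK : IsBorelGraph K)
    (hKG : K ≤ G) (hL : IsBorelGraph L) (hLG : L ≤ G) : Measurable fun x => Leaves K L x := by
  have h : ∀ x, Leaves K L x ↔ ∃ i j, K.Reachable x (γ i x) ∧ L.Adj (γ i x) (γ j x) ∧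
      ¬ K.Reachable x (γ j x) := by
    intro x
    constructor
    · rintro ⟨u, hu, v, huv, hv⟩
      obtain ⟨i, rfl⟩ := hγ.cover x u (hu.mono hKG)
      obtain ⟨j, rfl⟩ := hγ.cover x v ((hu.mono hKG).trans (hLG huv).reachable)
      exact ⟨i, j, hu, huv, hv⟩
    · rintro ⟨i, j, hu, huv, hv⟩
      exact ⟨_, hu, _, huv, hv⟩
  simp only [h]
  have hr := fun k => hγ.measurable_reachable hK hKG measurable_id (hγ.measurable k)
  exact Measurable.exists fun i => Measurable.exists fun j => (hr i).and
    ((hL.measurable_adj (hγ.measurable i) (hγ.measurable j)).and (hr j).not)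

theorem measurable_leaveRank (hγ : IsReachableCover G γ) (hH : IsHyperfiniteWitness G H)
    (hK : IsTame G H K) (hinf : ∀ x, {y | G.Reachable x y}.Infinite) :
    Measurable (leaveRank H K) := by
  classical
  have hex := exists_leaves (K := K) hH.iSup_eq hK.hasFiniteComponents hinf
  have : leaveRank H K = fun x => Nat.find (hex x) := by
    ext x
    exact Nat.sInf_def (s := {m | Leaves K (H m) x}) (hex x)
  rw [this]
  refine measurable_find hex fun m => measurableSet_setOfPred.2 (measurable_leaves hγ hK.borel
    hK.le (hH.borel m) ?_)
  rw [← hH.iSup_eq]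
  exact le_iSup H m

/-- Merging all components of equal rank that are joined by an edge witnessing the rank
preserves tameness. -/
theorem IsTame.exists_merge (hγ : IsReachableCover G γ) (hH : IsHyperfiniteWitness G H)
    (hinf : ∀ x, {y | G.Reachable x y}.Infinite) (hK : IsTame G H K) :
    ∃ K', IsTame G H K' ∧ K ≤ K' ∧ ∀ a b, leaveRank H K a = leaveRank H K b →
      (H (leaveRank H K a)).Adj a b → K'.Adj a b := by
  set r := leaveRank H K with hr
  have hrm : Measurable r := measurable_leaveRank hγ hH hK hinf
  have hHG : ∀ m, H m ≤ G := fun m => hH.iSup_eq ▸ le_iSup H m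
  let R : X → X → Prop := fun a b => r a = r b ∧ (H (r a)).Adj a b
  refine ⟨K ⊔ SimpleGraph.fromRel R, ⟨hK.borel.sup (isBorelGraph_fromRel ?_), ?_, ?_⟩,
    le_sup_left, fun a b h1 h2 => SimpleGraph.adj_sup_fromRel h2.ne ⟨h1, h2⟩⟩
  · exact Measurable.and (measurableSet_setOfPred.1 (measurableSet_eq_fun
      (hrm.comp measurable_fst) (hrm.comp measurable_snd)))
      (measurable_rank_adj hH.borel (hrm.comp measurable_fst) measurable_fst measurable_snd)
  · intro a b h
    rcases SimpleGraph.Adj.sup_fromRel h with h | h | h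
    · exact hK.le h
    · exact hHG _ h.2
    · exact (hHG _ h.2).symm
  · intro m x
    -- A path from `x` stays in rank at most `M`: edges of `K` and added edges preserve rank, and an
    -- edge of `H m` between different `K`-components forces rank at most `m` at its endpoints.
    -- Hence every added edge on the path lies in `H M`.
    set M := max (r x) m with hM
    refine (hK.finite M x).subset fun y hy => ?_
    have hy' : ((K ⊔ SimpleGraph.fromRel R) ⊔ H m).Reachable x y := hy
    rw [SimpleGraph.reachable_iff_reflTransGen] at hy'
    suffices h : r y ≤ M ∧ (K ⊔ H M).Reachable x y from h.2
    clear hy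
    induction hy' with
    | refl => exact ⟨le_max_left _ _, .rfl⟩
    | @tail a b _ h ih =>
      obtain ⟨ih1, ih2⟩ := ih
      have hmono : ∀ {n}, n ≤ M → (H n).Adj a b → (K ⊔ H M).Reachable x b := fun hn h =>
        ih2.trans (SimpleGraph.Adj.reachable (Or.inr (hH.mono hn h)))
      rcases h with h | h
      · rcases SimpleGraph.Adj.sup_fromRel h with h | h | h
        · exact ⟨(leaveRank_congr (H := H) h.reachable).symm.trans_le ih1,
            ih2.trans (SimpleGraph.Adj.reachable (Or.inl h))⟩
        · exact ⟨h.1.symm.trans_le ih1, hmono ih1 h.2⟩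
        · exact ⟨h.1.trans_le ih1, hmono (h.1.trans_le ih1) h.2.symm⟩
      · refine ⟨?_, hmono (le_max_right _ _) h⟩
        by_cases hab : K.Reachable a b
        · exact (leaveRank_congr (H := H) hab).symm.trans_le ih1
        · exact (leaveRank_le h.symm fun h' => hab h'.symm).trans (le_max_right _ _)

/-- If every component inside `B` has an edge witnessing its rank that leads out of `B`, then
these components can be attached to the complement of `B` preserving tameness. -/
theorem IsTame.exists_attach (hγ : IsReachableCover G γ) (hH : IsHyperfiniteWitness G H)
    (hloc : ∀ x, (G.neighborSet x).Finite)
    (hinf : ∀ x, {y | G.Reachable x y}.Infinite) (hK : IsTame G H K) {B : Set X}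
    (hBm : MeasurableSet B) (hB : ∀ x y, K.Reachable x y → x ∈ B → y ∈ B)
    (hout : ∀ x ∈ B, ∃ u, K.Reachable x u ∧ ∃ v, (H (leaveRank H K x)).Adj u v ∧ v ∉ B) :
    ∃ K', IsTame G H K' ∧ K ≤ K' ∧ ∀ x ∈ B, ∃ y, y ∉ B ∧ K'.Reachable x y := by
  classical
  set r := leaveRank H K with hr
  have hrm : Measurable r := measurable_leaveRank hγ hH hK hinf
  have hHG : ∀ m, H m ≤ G := fun m => hH.iSup_eq ▸ le_iSup H m
  obtain ⟨t, htm, ht, htc⟩ := hγ.exists_measurable_selector hK.borel hK.le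
    hK.hasFiniteComponents
  let p : ℕ → X → Prop := fun k z => z ∉ B ∨ (γ k z ∉ B ∧ ∃ j, K.Reachable z (γ j z) ∧
    (H (r z)).Adj (γ j z) (γ k z))
  have hp : ∀ k, MeasurableSet {z | p k z} := fun k => by
    refine measurableSet_setOfPred.2 (Measurable.or (Measurable.not ?_) (Measurable.and
      (Measurable.not ?_) (Measurable.exists fun j => Measurable.and
        (hγ.measurable_reachable hK.borel hK.le measurable_id (hγ.measurable j))
        (measurable_rank_adj hH.borel hrm (hγ.measurable j) (hγ.measurable k)))))
    · exact measurableSet_setOfPred.1 hBm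
    · exact measurableSet_setOfPred.1 (hγ.measurable k hBm)
  have hex : ∀ z, ∃ k, p k z := by
    intro z
    by_cases hz : z ∈ B
    · obtain ⟨u, hu, v, huv, hv⟩ := hout z hz
      obtain ⟨j, rfl⟩ := hγ.cover z u (hu.mono hK.le)
      obtain ⟨k, rfl⟩ := hγ.cover z v ((hu.mono hK.le).trans (hHG _ huv).reachable)
      exact ⟨k, Or.inr ⟨hv, j, hu, huv⟩⟩
    · exact ⟨0, Or.inl hz⟩
  let w : X → X := fun z => γ (Nat.find (hex z)) z
  have hwm : Measurable w := Measurable.find hγ.measurable hp hex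
  -- Choosing the target at the representative `t x` gives each `K`-component a single target.
  let v : X → X := fun x => w (t x)
  have hv : ∀ x ∈ B, v x ∉ B ∧ ∃ u, K.Reachable x u ∧ (H (r x)).Adj u (v x) := by
    intro x hx
    rcases Nat.find_spec (hex (t x)) with h | ⟨h1, j, h2, h3⟩
    · exact absurd (hB _ _ (ht x) hx) h
    · refine ⟨h1, _, (ht x).trans h2, ?_⟩
      have : r x = r (t x) := leaveRank_congr (H := H) (ht x)
      rw [this]
      exact h3
  have hvc : ∀ a b, K.Reachable a b → v a = v b := fun a b h => congrArg w (htc a b h)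
  let R : X → X → Prop := fun a b => a ∈ B ∧ b = v a ∧ (H (r a)).Adj a b
  refine ⟨K ⊔ SimpleGraph.fromRel R, ⟨hK.borel.sup (isBorelGraph_fromRel ?_), ?_, ?_⟩,
    le_sup_left, ?_⟩
  · refine Measurable.and (measurableSet_setOfPred.1 (measurable_fst hBm)) (Measurable.and
      (measurableSet_setOfPred.1 (measurableSet_eq_fun measurable_snd
        ((hwm.comp htm).comp measurable_fst)))
      (measurable_rank_adj hH.borel (hrm.comp measurable_fst) measurable_fst measurable_snd))
  · intro a b h
    rcases SimpleGraph.Adj.sup_fromRel h with h | h | h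
    · exact hK.le h
    · exact hHG _ h.2.2
    · exact (hHG _ h.2.2).symm
  · intro m
    -- Edges added at rank at most `m` already lie in `H m`. Components of larger rank are not left
    -- by any edge of `H m`, so they remain components of `K ⊔ H m` and only they need attaching.
    refine HasFiniteComponents.attach (L := K ⊔ H m) (B := {x | x ∈ B ∧ m < r x}) (v := v)
      hloc (hK.finite m) ?_ ?_ ?_
    · rintro a b hab ⟨ha, hm⟩
      have hab' : K.Reachable a b := by
        rcases hab with h | h
        · exact h.reachable
        · exact reachable_of_lt_leaveRank hm h
      exact ⟨⟨hB a b hab' ha, hm.trans_eq (leaveRank_congr (H := H) hab')⟩, hvc a b hab'⟩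
    · rintro x ⟨hx, -⟩
      obtain ⟨-, u, hu, huv⟩ := hv x hx
      exact ⟨u, hu.mono le_sup_left, hHG _ huv⟩
    · have key : ∀ a b, R a b → (K ⊔ H m).Adj a b ∨
          ((a ∈ B ∧ m < r a) ∧ ¬ (b ∈ B ∧ m < r b) ∧ b = v a) := by
        rintro a b ⟨ha, rfl, hab⟩
        rcases le_or_gt (r a) m with h | h
        · exact Or.inl (Or.inr (hH.mono h hab))
        · exact Or.inr ⟨⟨ha, h⟩, fun hb => (hv a ha).1 hb.1, rfl⟩
      intro a b h
      rcases h with h | h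
      · rcases SimpleGraph.Adj.sup_fromRel h with h | h | h
        · exact Or.inl (Or.inl h)
        · exact (key a b h).imp_right Or.inl
        · exact (key b a h).imp SimpleGraph.Adj.symm Or.inr
      · exact Or.inl (Or.inr h)
  · intro x hx
    obtain ⟨h1, u, hu, huv⟩ := hv x hx
    refine ⟨v x, h1, (hu.mono le_sup_left).trans (SimpleGraph.Adj.reachable
      (SimpleGraph.adj_sup_fromRel huv.ne ⟨hB _ _ hu hx, hvc x u hu, ?_⟩))⟩
    have : r x = r u := leaveRank_congr (H := H) hu
    rw [← this]
    exact huv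

end Rank

theorem SimpleGraph.supp_connectedComponentMk {X : Type*} (K : SimpleGraph X) (x : X) :
    (K.connectedComponentMk x).supp = {y | K.Reachable x y} := by
  ext y
  simp [SimpleGraph.ConnectedComponent.mem_supp_iff, SimpleGraph.reachable_comm]

/-! ### The kernel, by recursion on rank -/

/-- Every edge of `L` leaving the component of `x` in `K` leads into `B \ S`. -/
def AvoidsOutside {X : Type*} (K L : SimpleGraph X) (B S : Set X) (x : X) : Prop :=
  ∀ u v, K.Reachable x u → L.Adj u v → ¬ K.Reachable x v → v ∈ B ∧ v ∉ S

/-- The part of rank less than `n` of the kernel of the relation that joins `x ∈ B` to the points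
outside its component in `K` reached by edges witnessing the rank of `x`. A point of `B` lies in
the kernel iff all points it is joined to lie in `B` but not in the kernel. -/
def kernelBelow {X : Type*} (K : SimpleGraph X) (H : ℕ → SimpleGraph X) (B : Set X) : ℕ → Set X
  | 0 => ∅
  | n + 1 => kernelBelow K H B n ∪
      {x | x ∈ B ∧ leaveRank H K x = n ∧ AvoidsOutside K (H n) B (kernelBelow K H B n) x}

section Kernel

variable {X : Type*} {G K : SimpleGraph X} {H : ℕ → SimpleGraph X} {B : Set X}

theorem avoidsOutside_congr {L : SimpleGraph X} {S : Set X} {x y : X} (h : K.Reachable x y) :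
    AvoidsOutside K L B S x ↔ AvoidsOutside K L B S y := by
  have h1 : ∀ z, K.Reachable x z ↔ K.Reachable y z := fun z =>
    ⟨fun h' => h.symm.trans h', fun h' => h.trans h'⟩
  simp only [AvoidsOutside, h1]

theorem mem_kernelBelow {n : ℕ} {x : X} : x ∈ kernelBelow K H B n ↔ x ∈ B ∧ leaveRank H K x < n ∧
    AvoidsOutside K (H (leaveRank H K x)) B (kernelBelow K H B (leaveRank H K x)) x := by
  induction n with
  | zero => simp [kernelBelow]
  | succ n ih =>
    rw [kernelBelow, Set.mem_union, ih, Set.mem_ofPred_eq, Nat.lt_succ_iff_lt_or_eq]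
    constructor
    · rintro (⟨h1, h2, h3⟩ | ⟨h1, rfl, h3⟩)
      · exact ⟨h1, Or.inl h2, h3⟩
      · exact ⟨h1, Or.inr rfl, h3⟩
    · rintro ⟨h1, h2 | rfl, h3⟩
      · exact Or.inl ⟨h1, h2, h3⟩
      · exact Or.inr ⟨h1, rfl, h3⟩

theorem mem_iUnion_kernelBelow {x : X} : x ∈ ⋃ n, kernelBelow K H B n ↔ x ∈ B ∧
    AvoidsOutside K (H (leaveRank H K x)) B (kernelBelow K H B (leaveRank H K x)) x := by
  simp only [Set.mem_iUnion, mem_kernelBelow]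
  exact ⟨fun ⟨_, h1, _, h3⟩ => ⟨h1, h3⟩, fun ⟨h1, h3⟩ => ⟨_, h1, Nat.lt_succ_self _, h3⟩⟩

variable [MeasurableSpace X] [StandardBorelSpace X] {γ : ℕ → X → X}

theorem measurableSet_kernelBelow (hγ : IsReachableCover G γ) (hH : IsHyperfiniteWitness G H)
    (hinf : ∀ x, {y | G.Reachable x y}.Infinite) (hK : IsTame G H K) (hB : MeasurableSet B)
    (n : ℕ) : MeasurableSet (kernelBelow K H B n) := by
  induction n with
  | zero => exact MeasurableSet.empty
  | succ n ih =>
    have h : ∀ x, AvoidsOutside K (H n) B (kernelBelow K H B n) x ↔ ∀ i j,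
        K.Reachable x (γ i x) → (H n).Adj (γ i x) (γ j x) → ¬ K.Reachable x (γ j x) →
          γ j x ∈ B ∧ γ j x ∉ kernelBelow K H B n := by
      intro x
      constructor
      · exact fun h i j => h _ _
      · intro h u v hu huv
        obtain ⟨i, rfl⟩ := hγ.cover x u (hu.mono hK.le)
        have hv : G.Adj (γ i x) v := hH.iSup_eq ▸ (le_iSup H n) huv
        obtain ⟨j, rfl⟩ := hγ.cover x v ((hu.mono hK.le).trans hv.reachable)
        exact h i j hu huv
    have hr := fun k => hγ.measurable_reachable hK.borel hK.le measurable_id (hγ.measurable k)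
    have hA : Measurable fun x => AvoidsOutside K (H n) B (kernelBelow K H B n) x := by
      simp only [h]
      refine Measurable.forall fun i => Measurable.forall fun j => (hr i).imp
        (((hH.borel n).measurable_adj (hγ.measurable i) (hγ.measurable j)).imp
          ((hr j).not.imp (Measurable.and ?_ (Measurable.not ?_))))
      · exact measurableSet_setOfPred.1 (hγ.measurable j hB)
      · exact measurableSet_setOfPred.1 (hγ.measurable j ih)
    exact ih.union (hB.inter ((measurable_leaveRank hγ hH hK hinf
      (measurableSet_singleton n)).inter (measurableSet_setOfPred.2 hA)))

end Kernel

/-! ### The enlargement step and its iteration -/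

/-- The set of points whose component in `K'` is not larger than that in `K`. -/
def unchangedSet {X : Type*} (K K' : SimpleGraph X) : Set X :=
  {x | ∀ y, K'.Reachable x y → K.Reachable x y}

section Step

variable {X : Type*} {G K K' : SimpleGraph X} {H : ℕ → SimpleGraph X}

theorem unchangedSet_invariant {x y : X} (h : K'.Reachable x y)
    (hx : x ∈ unchangedSet K K') : y ∈ unchangedSet K K' := fun z hz =>
  (hx y h).symm.trans (hx z (h.trans hz))

variable [MeasurableSpace X]

theorem IsTame.sup (hH : IsHyperfiniteWitness G H) (hK : IsTame G H K) (n : ℕ) :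
    IsTame G H (K ⊔ H n) where
  borel := hK.borel.sup (hH.borel n)
  le := sup_le hK.le (hH.iSup_eq ▸ le_iSup H n)
  finite m := (hK.finite (max n m)).mono (sup_le (sup_le_sup_left (hH.mono (le_max_left n m)) K)
    ((hH.mono (le_max_right n m)).trans le_sup_right))

theorem isTame_bot (hH : IsHyperfiniteWitness G H) : IsTame G H ⊥ where
  borel := by simp [IsBorelGraph]
  le := bot_le
  finite m x := by
    rw [bot_sup_eq, ← SimpleGraph.supp_connectedComponentMk]
    exact hH.finite m _

variable [StandardBorelSpace X] {γ : ℕ → X → X}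

theorem measurableSet_unchangedSet (hγ : IsReachableCover G γ) (hK : IsBorelGraph K)
    (hKG : K ≤ G) (hK' : IsBorelGraph K') (hKG' : K' ≤ G) :
    MeasurableSet (unchangedSet K K') := by
  have h : unchangedSet K K' = {x | ∀ k, K'.Reachable x (γ k x) → K.Reachable x (γ k x)} := by
    ext x
    refine ⟨fun h k => h _, fun h y hy => ?_⟩
    obtain ⟨k, rfl⟩ := hγ.cover x y (hy.mono hKG')
    exact h k hy
  rw [h]
  exact measurableSet_setOfPred.2 (Measurable.forall fun k =>
    (hγ.measurable_reachable hK' hKG' measurable_id (hγ.measurable k)).imp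
      (hγ.measurable_reachable hK hKG measurable_id (hγ.measurable k)))

/-- Every tame graph extends to a tame graph all of whose components are strictly larger. -/
theorem IsTame.exists_enlarge (hγ : IsReachableCover G γ) (hH : IsHyperfiniteWitness G H)
    (hloc : ∀ x, (G.neighborSet x).Finite) (hinf : ∀ x, {y | G.Reachable x y}.Infinite)
    (hK : IsTame G H K) :
    ∃ K', IsTame G H K' ∧ K ≤ K' ∧ ∀ x, ∃ y, K'.Reachable x y ∧ ¬ K.Reachable x y := by
  obtain ⟨K₀, hK₀, h₀, hmerge⟩ := hK.exists_merge hγ hH hinf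
  set B := unchangedSet K K₀ with hBdef
  have hBm : MeasurableSet B := measurableSet_unchangedSet hγ hK.borel hK.le hK₀.borel hK₀.le
  have hBrank : ∀ x ∈ B, leaveRank H K x = leaveRank H K₀ x := fun x hx =>
    leaveRank_eq_of_reachable_iff fun y => ⟨fun h => h.mono h₀, hx y⟩
  -- The same edge also leaves the component of `v`, so the rank of `v` is no larger. Equality is
  -- impossible, as the edge would have been merged into `K₀`.
  have hlt : ∀ x ∈ B, ∀ u, K₀.Reachable x u → ∀ v, (H (leaveRank H K₀ x)).Adj u v →
      ¬ K₀.Reachable x v → v ∈ B → leaveRank H K₀ v < leaveRank H K₀ x := by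
    intro x hx u hu v huv hv hvB
    refine lt_of_le_of_ne (leaveRank_le huv.symm fun h => hv (hu.trans h.symm)) fun heq => hv ?_
    have hu' : leaveRank H K u = leaveRank H K₀ x := by
      rw [hBrank u (unchangedSet_invariant hu hx), leaveRank_congr hu]
    refine hu.trans (hmerge u v ?_ ?_).reachable
    · rw [hu', hBrank v hvB, heq]
    · rwa [hu']
  set T := ⋃ n, kernelBelow K₀ H B n with hT
  have hTm : MeasurableSet T :=
    MeasurableSet.iUnion fun n => measurableSet_kernelBelow hγ hH hinf hK₀ hBm n
  have hTinv : ∀ x y, K₀.Reachable x y → x ∈ T → y ∈ T := by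
    intro x y h hx
    rw [hT, mem_iUnion_kernelBelow] at hx ⊢
    rw [← leaveRank_congr h, ← avoidsOutside_congr h]
    exact ⟨unchangedSet_invariant h hx.1, hx.2⟩
  -- A point of `B \ T` violates the kernel condition, so some witnessing edge leads into `T` or out
  -- of `B`.
  obtain ⟨K₁, hK₁, h₁, hout₁⟩ := hK₀.exists_attach hγ hH hloc hinf (B := B \ T)
    (hBm.diff hTm) (fun x y h hx => ⟨unchangedSet_invariant h hx.1,
      fun hy => hx.2 (hTinv y x h.symm hy)⟩) (by
      rintro x ⟨hxB, hxT⟩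
      rw [hT, mem_iUnion_kernelBelow] at hxT
      have hxT' : ¬ AvoidsOutside K₀ (H (leaveRank H K₀ x)) B
          (kernelBelow K₀ H B (leaveRank H K₀ x)) x := fun h => hxT ⟨hxB, h⟩
      rw [AvoidsOutside] at hxT'
      push Not at hxT'
      obtain ⟨u, v, hu, huv, -, hv⟩ := hxT'
      refine ⟨u, hu, v, huv, fun hv' => hv'.2 ?_⟩
      exact Set.mem_iUnion.2 ⟨_, hv hv'.1⟩)
  have hsub : ∀ x ∈ unchangedSet K K₁, x ∈ T := by
    intro x hx
    by_contra hxT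
    have hxB : x ∈ B := fun y hy => hx y (hy.mono h₁)
    obtain ⟨y, hy, hxy⟩ := hout₁ x ⟨hxB, hxT⟩
    have hxy' : K₀.Reachable x y := (hx y hxy).mono h₀
    exact hy ⟨unchangedSet_invariant hxy' hxB, fun h => hxT (hTinv y x hxy'.symm h)⟩
  -- Whatever is still unchanged lies in `T`, so its witnessing edges lead into `B` outside the
  -- kernel below its rank. By `hlt` the endpoint has smaller rank, hence is outside `T` altogether
  -- and was already enlarged.
  obtain ⟨K₂, hK₂, h₂, hout₂⟩ := hK₁.exists_attach hγ hH hloc hinf (B := unchangedSet K K₁)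
    (measurableSet_unchangedSet hγ hK.borel hK.le hK₁.borel hK₁.le)
    (fun x y h hx => unchangedSet_invariant h hx) (by
      intro x hx
      have hxT := hsub x hx
      have hrank : leaveRank H K₁ x = leaveRank H K₀ x :=
        (leaveRank_eq_of_reachable_iff fun y =>
          ⟨fun h => h.mono h₁, fun h => (hx y h).mono h₀⟩).symm
      rw [hrank]
      obtain ⟨u, hu, v, huv, hv⟩ := leaves_leaveRank
        (exists_leaves hH.iSup_eq hK₀.hasFiniteComponents hinf x)
      refine ⟨u, hu.mono h₁, v, huv, fun hv' => ?_⟩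
      obtain ⟨hxB, hxa⟩ := mem_iUnion_kernelBelow.1 hxT
      obtain ⟨hvB, hvS⟩ := hxa u v hu huv hv
      exact hvS (mem_kernelBelow.2 ⟨hvB, hlt x hxB u hu v huv hv hvB,
        (mem_iUnion_kernelBelow.1 (hsub v hv')).2⟩))
  refine ⟨K₂, hK₂, h₀.trans (h₁.trans h₂), fun x => ?_⟩
  by_cases hx : x ∈ unchangedSet K K₁
  · obtain ⟨y, hy, hxy⟩ := hout₂ x hx
    exact ⟨y, hxy, fun h => hy (unchangedSet_invariant (h.mono (h₀.trans h₁)) hx)⟩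
  · simp only [unchangedSet, Set.mem_ofPred_eq, not_forall] at hx
    obtain ⟨y, hy, hxy⟩ := hx
    exact ⟨y, hy.mono h₂, hxy⟩

/-- A hyperfinite Borel graph of bounded degree with infinite components is an increasing union
of Borel graphs with finite components whose sizes tend uniformly to infinity. -/
theorem hasLargeWitness_of_isHyperfinite (hG : IsBorelGraph G) (hdeg : HasBoundedDegree G)
    (hhyp : IsHyperfinite G) (hinf : ∀ c : G.ConnectedComponent, c.supp.Infinite) :
    HasLargeWitness G := by
  obtain ⟨H, hH⟩ := hhyp
  obtain ⟨γ, hγm, hγc⟩ := exists_measurable_reachable_cover hG hdeg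
  have hγ : IsReachableCover G γ := ⟨hγm, hγc⟩
  have hloc : ∀ x, (G.neighborSet x).Finite := fun x =>
    Set.finite_of_encard_le_coe (hdeg.choose_spec x)
  have hinf' : ∀ x, {y | G.Reachable x y}.Infinite := fun x => by
    rw [← SimpleGraph.supp_connectedComponentMk]
    exact hinf _
  choose f hf hle hlarge using fun K : {K // IsTame G H K} =>
    K.2.exists_enlarge hγ hH hloc hinf'
  let K : ℕ → {K // IsTame G H K} := fun n => Nat.rec ⟨⊥, isTame_bot hH⟩
    (fun n K => ⟨f K ⊔ H n, (hf K).sup hH n⟩) n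
  have hsucc : ∀ n, (K (n + 1)).1 = f (K n) ⊔ H n := fun n => rfl
  refine ⟨fun n => (K n).1, ⟨fun n => (K n).2.borel, ?_, fun n c => ?_, ?_⟩, fun n c => ?_⟩
  · exact monotone_nat_of_le_succ fun n => (hle (K n)).trans le_sup_left
  · induction c using SimpleGraph.ConnectedComponent.ind with
    | h x =>
      rw [SimpleGraph.supp_connectedComponentMk]
      exact (K n).2.hasFiniteComponents x
  · refine le_antisymm (iSup_le fun n => (K n).2.le) ?_
    nth_rw 1 [← hH.iSup_eq]
    exact iSup_le fun n => le_trans (le_sup_right.trans_eq (hsucc n).symm)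
      (le_iSup (fun n => (K n).1) (n + 1))
  · induction c using SimpleGraph.ConnectedComponent.ind with
    | h x =>
      rw [SimpleGraph.supp_connectedComponentMk]
      induction n with
      | zero => simp
      | succ n ih =>
        obtain ⟨y, hy, hxy⟩ := hlarge (K n) x
        have hss : {y | (K n).1.Reachable x y} ⊂ {y | (K (n + 1)).1.Reachable x y} :=
          (Set.ssubset_iff_of_subset fun z hz =>
            SimpleGraph.Reachable.mono ((hle (K n)).trans le_sup_left) hz).2
            ⟨y, hy.mono le_sup_left, hxy⟩
        have := ((K n).2.hasFiniteComponents x).encard_lt_encard hss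
        push_cast
        exact (add_le_add_left ih 1).trans (Order.add_one_le_of_lt this)

end Step

/-! ### Transfer to the induced graph on the whole space -/

theorem SimpleGraph.Iso.supp_eq_preimage {X Y : Type*} {K : SimpleGraph X} {L : SimpleGraph Y}
    (φ : K ≃g L) (c : K.ConnectedComponent) : c.supp = φ ⁻¹' (c.map φ.toHom).supp := by
  induction c using SimpleGraph.ConnectedComponent.ind with
  | h x =>
    ext y
    exact SimpleGraph.ConnectedComponent.eq.trans
      (φ.reachable_iff.symm.trans SimpleGraph.ConnectedComponent.eq.symm)

theorem HasLargeWitness.comap_measurableEquiv {X Y : Type*} [MeasurableSpace X]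
    [MeasurableSpace Y] {G : SimpleGraph Y} (h : HasLargeWitness G) (e : X ≃ᵐ Y) :
    HasLargeWitness (G.comap e) := by
  obtain ⟨H, hH, hlarge⟩ := h
  let φ : ∀ n, (H n).comap e ≃g H n := fun n => SimpleGraph.Iso.comap e.toEquiv (H n)
  refine ⟨fun n => (H n).comap e, ⟨fun n => ?_, fun m n hmn => ?_, fun n c => ?_, ?_⟩,
    fun n c => ?_⟩
  · exact (hH.borel n).preimage (e.measurable.prodMap e.measurable)
  · exact fun a b h => hH.mono hmn h
  · rw [(φ n).supp_eq_preimage c]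
    exact (hH.finite n _).preimage (φ n).injective.injOn
  · ext a b
    simp [← hH.iSup_eq]
  · rw [(φ n).supp_eq_preimage c, Set.encard_preimage_of_bijective (φ n).bijective]
    exact hlarge n _

theorem HasLargeWitness.induce_univ {X : Type*} [MeasurableSpace X] {G : SimpleGraph X}
    (h : HasLargeWitness G) : HasLargeWitness (G.induce Set.univ) :=
  h.comap_measurableEquiv (MeasurableEquiv.Set.univ X)

theorem proposition1p9 {X : Type*} [MeasurableSpace X] [StandardBorelSpace X]
    (G : SimpleGraph X) (hG : IsBorelGraph G) (hdeg : HasBoundedDegree G)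
    (hhyp : IsHyperfinite G) (hinf : ∀ c : G.ConnectedComponent, c.supp.Infinite) :
    (∀ (μ : MeasureTheory.Measure X) [MeasureTheory.IsProbabilityMeasure μ],
      ∃ A : Set X, MeasurableSet A ∧ IsGraphInvariant G A ∧ μ Aᶜ = 0 ∧
        HasLargeWitness (G.induce A)) ∧
    (∀ [TopologicalSpace X] [PolishSpace X] [BorelSpace X],
      ∃ A : Set X, MeasurableSet A ∧ IsGraphInvariant G A ∧ IsMeagre Aᶜ ∧
        HasLargeWitness (G.induce A)) ∧
    (∀ f : X → X, Measurable f → G = functionGraph f → HasLargeWitness G) := by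
  have h : HasLargeWitness G := hasLargeWitness_of_isHyperfinite hG hdeg hhyp hinf
  refine ⟨fun μ _ => ⟨Set.univ, .univ, fun _ _ _ _ => trivial, by simp, h.induce_univ⟩,
    ⟨Set.univ, .univ, fun _ _ _ _ => trivial, ?_, h.induce_univ⟩, fun _ _ _ => h⟩
  rw [Set.compl_univ]
  exact IsMeagre.empty
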